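/- Let $(M,g,J,\kappa)$ be an almost Kähler manifold: $M$ is a smooth (real, finite-dimensional, boundaryless) manifold, $\kappa$ is a symplectic form on $M$ (a smooth closed non-degenerate 2-form), $J$ is a smooth almost complex structure ($J\in\Gamma(\mathrm{End}(TM))$, $J^2=-\mathrm{Id}$), and $g(\cdot,\cdot)=\kappa(\cdot,J\cdot)$ is a $J$-Hermitian Riemannian metric. Let $\nabla$ be the Levi-Civita connection of $g$, let $\widetilde\nabla=\nabla-\tfrac12 J\nabla J$ be the Hermitian connection, i.e. $\widetilde\nabla_XY=\nabla_XY-\tfrac12 J(\nabla_XJ)Y$, and let $R$ and $\widetilde R$ be the curvature tensors of $\nabla$ and $\widetilde\nabla$, with $R(X,Y,Z,W)=g(R(X,Y)Z,W)$ and likewise for $\widetilde R$. For $p\in M$ let $\mathcal P^{1,1}_p(M)$ be the set of $J$-invariant (real two-dimensional) planes in $T_pM$. For $\sigma_1,\sigma_2\in\mathcal P^{1,1}_p(M)$ write $\sigma_1=\langle v,Jv\rangle$, $\sigma_2=\langle w,Jw\rangle$ with unit vectors $v,w\in T_pM$ and put $$K[p](\sigma_1,\sigma_2)=R(v,Jv,w,Jw),\qquad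 \widetilde K[p](\sigma_1,\sigma_2)=\widetilde R(v,Jv,w,Jw)$$ (the holomorphic bisectional curvature and the Hermitian bisectional curvature; these do not depend on the choice of $v$ and $w$). **Theorem.** If $K[p](\sigma_1,\sigma_2)=\widetilde K[p](\sigma_1,\sigma_2)$ for all $p\in M$ and all $\sigma_1,\sigma_2\in\mathcal P^{1,1}_p(M)$, then $J$ is integrable, i.e. its Nijenhuis tensor $N_J(X,Y)=[JX,JY]-J[JX,Y]-J[X,JY]-[X,Y]$ vanishes identically, and therefore $(M,g,J,\kappa)$ is a Kähler manifold (that is, an almost Kähler manifold with integrable $J$). -/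

import Mathlib

open scoped Manifold ContDiff

noncomputable section

namespace AlmostKahler

/-! ### Tensor calculus in coordinates, on a finite-dimensional real vector space `E` -/

section Coordinates

variable {E : Type*} [NormedAddCommGroup E] [NormedSpace ℝ E]

/-- The Christoffel symbols `Γ_y(u, v)` of a field `G` of scalar products on `E`, i.e. the
coefficients of its Levi-Civita connection `∇_u Y = D_u Y + Γ(u, Y)`: the vector `Γ_y(u, v)` is
determined by
`G_y(Γ_y(u, v), w) = ½ (D_u G (v, w) + D_v G (u, w) - D_w G (u, v))` for all `w`. -/
def christoffel (G : E → E →L[ℝ] E →L[ℝ] ℝ) (y u v : E) : E :=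
  (G y).inverse ((1 / 2 : ℝ) •
    (fderiv ℝ G y u v + fderiv ℝ G y v u - ((fderiv ℝ G y).flip u).flip v))

/-- The covariant derivative `(∇_u J) w = D_u J w + Γ(u, J w) - J Γ(u, w)` of a field of
endomorphisms `J`, for the connection with coefficients `Γ`. -/
def covDerivEnd (Γ : E → E → E → E) (J : E → E →L[ℝ] E) (y u w : E) : E :=
  fderiv ℝ J y u w + Γ y u (J y w) - J y (Γ y u w)

/-- The coefficients of the connection `∇ - ½ J ∇J`, where `∇` has coefficients `Γ`. -/
def hermitianCoeff (Γ : E → E → E → E) (J : E → E →L[ℝ] E) (y u w : E) : E :=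
  Γ y u w - (1 / 2 : ℝ) • J y (covDerivEnd Γ J y u w)

/-- The curvature `R(u, v) w = ∇_u ∇_v w - ∇_v ∇_u w` (`u`, `v`, `w` extended to constant fields,
so that `[u, v] = 0`) of the connection with coefficients `Γ`. -/
def curvature (Γ : E → E → E → E) (y u v w : E) : E :=
  fderiv ℝ (fun z => Γ z v w) y u - fderiv ℝ (fun z => Γ z u w) y v
    + Γ y u (Γ y v w) - Γ y v (Γ y u w)

/-- The exterior derivative of the field `κ` of alternating bilinear forms,
`dκ(u, v, w) = D_u κ (v, w) + D_v κ (w, u) + D_w κ (u, v)`. -/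
def extDerivTwo (κ : E → E →L[ℝ] E →L[ℝ] ℝ) (y u v w : E) : ℝ :=
  fderiv ℝ κ y u v w + fderiv ℝ κ y v w u + fderiv ℝ κ y w u v

/-- The Christoffel symbols are symmetric: the Levi-Civita connection is torsion-free. -/
theorem christoffel_symm (G : E → E →L[ℝ] E →L[ℝ] ℝ) (y u v : E)
    (hs : ∀ a b c, fderiv ℝ G y a b c = fderiv ℝ G y a c b) :
    christoffel G y u v = christoffel G y v u := by
  unfold christoffel
  congr 2
  ext w
  simp only [_root_.add_apply, _root_.sub_apply,
    ContinuousLinearMap.flip_apply]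
  rw [hs w u v]
  ring

/-- The equation that determines the Christoffel symbols. -/
theorem apply_christoffel [FiniteDimensional ℝ E] (G : E → E →L[ℝ] E →L[ℝ] ℝ) (y u v w : E)
    (hpos : ∀ a, a ≠ 0 → 0 < G y a a) :
    G y (christoffel G y u v) w =
      (1 / 2 : ℝ) * (fderiv ℝ G y u v w + fderiv ℝ G y v u w - fderiv ℝ G y w u v) := by
  have hinj : Function.Injective (G y) := by
    rw [injective_iff_map_eq_zero]
    intro a ha
    by_contra hne
    have := hpos a hne
    rw [ha] at this
    simp at this
  have hdim : Module.finrank ℝ E = Module.finrank ℝ (E →L[ℝ] ℝ) := by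
    rw [← (LinearMap.toContinuousLinearMap (𝕜 := ℝ) (E := E) (F' := ℝ)).finrank_eq]
    exact (Subspace.dual_finrank_eq (K := ℝ) (V := E)).symm
  let e : E ≃L[ℝ] (E →L[ℝ] ℝ) :=
    (LinearEquiv.ofInjectiveOfFinrankEq (G y : E →ₗ[ℝ] (E →L[ℝ] ℝ)) hinj
      hdim).toContinuousLinearEquiv
  have he : (e : E →L[ℝ] (E →L[ℝ] ℝ)) = G y := by
    ext a b
    rfl
  unfold christoffel
  rw [← he, ContinuousLinearMap.inverse_equiv]
  simp

/-- The Levi-Civita connection is metric. -/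
theorem fderiv_metric [FiniteDimensional ℝ E] (G : E → E →L[ℝ] E →L[ℝ] ℝ) (y u v w : E)
    (hpos : ∀ a, a ≠ 0 → 0 < G y a a) (hsymm : ∀ a b, G y a b = G y b a)
    (hs : ∀ a b c, fderiv ℝ G y a b c = fderiv ℝ G y a c b) :
    fderiv ℝ G y u v w = G y (christoffel G y u v) w + G y v (christoffel G y u w) := by
  rw [hsymm v, apply_christoffel G y u v w hpos, apply_christoffel G y u w v hpos,
    hs u w v, hs v u w, hs w u v]
  ring

end Coordinates

/-! ### Tensor fields on a manifold, and their expression in the chart around a point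

The manifold `M` is modelled on the finite-dimensional real vector space `E`, without boundary. -/

section Manifold

variable {E : Type*} [NormedAddCommGroup E] [NormedSpace ℝ E]
  {M : Type*} [TopologicalSpace M] [ChartedSpace E M]

/-- The expression of a field `B` of bilinear forms on the tangent spaces in the chart `φ` around
`p`: at `y` in the target of `φ`, the pullback of `B` under the differential of `φ⁻¹` at `y`. -/
def bilinInChart (B : ∀ x : M, TangentSpace 𝓘(ℝ, E) x →L[ℝ] TangentSpace 𝓘(ℝ, E) x →L[ℝ] ℝ)
    (p : M) (y : E) : E →L[ℝ] E →L[ℝ] ℝ :=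
  let φ := extChartAt 𝓘(ℝ, E) p
  let dψ : E →L[ℝ] E := mfderiv 𝓘(ℝ, E) 𝓘(ℝ, E) φ.symm y
  let b : E →L[ℝ] E →L[ℝ] ℝ := B (φ.symm y)
  b.bilinearComp dψ dψ

/-- The expression of a field `J` of endomorphisms of the tangent spaces in the chart `φ` around
`p`: at `y` in the target of `φ`, the conjugate of `J` by the differential of `φ`. -/
def endInChart (J : ∀ x : M, TangentSpace 𝓘(ℝ, E) x →L[ℝ] TangentSpace 𝓘(ℝ, E) x)
    (p : M) (y : E) : E →L[ℝ] E :=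
  let φ := extChartAt 𝓘(ℝ, E) p
  let dψ : E →L[ℝ] E := mfderiv 𝓘(ℝ, E) 𝓘(ℝ, E) φ.symm y
  let j : E →L[ℝ] E := J (φ.symm y)
  let dφ : E →L[ℝ] E := mfderiv 𝓘(ℝ, E) 𝓘(ℝ, E) φ (φ.symm y)
  dφ ∘L j ∘L dψ

/-- The Nijenhuis tensor `N_J(X, Y) = [JX, JY] - J[JX, Y] - J[X, JY] - [X, Y]`. -/
def nijenhuis (J : ∀ x : M, TangentSpace 𝓘(ℝ, E) x →L[ℝ] TangentSpace 𝓘(ℝ, E) x)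
    (X Y : ∀ x : M, TangentSpace 𝓘(ℝ, E) x) (x : M) : TangentSpace 𝓘(ℝ, E) x :=
  VectorField.mlieBracket 𝓘(ℝ, E) (fun z => J z (X z)) (fun z => J z (Y z)) x
    - J x (VectorField.mlieBracket 𝓘(ℝ, E) (fun z => J z (X z)) Y x)
    - J x (VectorField.mlieBracket 𝓘(ℝ, E) X (fun z => J z (Y z)) x)
    - VectorField.mlieBracket 𝓘(ℝ, E) X Y x

/-- `J` is integrable if its Nijenhuis tensor vanishes: `N_J(X, Y)(x) = 0` for all points `x` and
all vector fields `X`, `Y` that are smooth at `x` (in particular for all smooth vector fields, local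
or global). -/
def IsIntegrable [IsManifold 𝓘(ℝ, E) ∞ M]
    (J : ∀ x : M, TangentSpace 𝓘(ℝ, E) x →L[ℝ] TangentSpace 𝓘(ℝ, E) x) : Prop :=
  ∀ (x : M) (X Y : ∀ z : M, TangentSpace 𝓘(ℝ, E) z),
    ContMDiffAt 𝓘(ℝ, E) (𝓘(ℝ, E).prod 𝓘(ℝ, E)) ∞
      (fun z => Bundle.TotalSpace.mk' E (E := fun z : M => TangentSpace 𝓘(ℝ, E) z) z (X z)) x →
    ContMDiffAt 𝓘(ℝ, E) (𝓘(ℝ, E).prod 𝓘(ℝ, E)) ∞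
      (fun z => Bundle.TotalSpace.mk' E (E := fun z : M => TangentSpace 𝓘(ℝ, E) z) z (Y z)) x →
    nijenhuis J X Y x = 0

end Manifold

/-! ### Almost Kähler structures -/

/-- An almost Kähler structure `(g, J, κ)` on the manifold `M`: a symplectic form `κ` and a
`κ`-calibrated almost complex structure `J`, with `g = κ(·, J ·)` the associated Riemannian metric.
That `g` is `J`-invariant and that `κ` is non-degenerate follows, see `AlmostKahlerStructure.metric_J`
and `AlmostKahlerStructure.nondegenerate`. -/
structure AlmostKahlerStructure (E : Type*) [NormedAddCommGroup E] [NormedSpace ℝ E]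
    (M : Type*) [TopologicalSpace M] [ChartedSpace E M] [IsManifold 𝓘(ℝ, E) ∞ M] where
  /-- The smooth Riemannian metric. -/
  g : Bundle.ContMDiffRiemannianMetric 𝓘(ℝ, E) ∞ E (fun x : M => TangentSpace 𝓘(ℝ, E) x)
  /-- The almost complex structure, a smooth section of `End(TM)` with `J² = -Id`. -/
  J : ∀ x : M, TangentSpace 𝓘(ℝ, E) x →L[ℝ] TangentSpace 𝓘(ℝ, E) x
  contMDiff_J : ContMDiff 𝓘(ℝ, E) (𝓘(ℝ, E).prod 𝓘(ℝ, E →L[ℝ] E)) ∞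
    (fun x => Bundle.TotalSpace.mk' (E →L[ℝ] E)
      (E := fun x : M => TangentSpace 𝓘(ℝ, E) x →L[ℝ] TangentSpace 𝓘(ℝ, E) x) x (J x))
  J_J : ∀ (x : M) (v : TangentSpace 𝓘(ℝ, E) x), J x (J x v) = -v
  /-- The symplectic form, a smooth closed 2-form. -/
  κ : ∀ x : M, TangentSpace 𝓘(ℝ, E) x →L[ℝ] TangentSpace 𝓘(ℝ, E) x →L[ℝ] ℝ
  contMDiff_κ : ContMDiff 𝓘(ℝ, E) (𝓘(ℝ, E).prod 𝓘(ℝ, E →L[ℝ] E →L[ℝ] ℝ)) ∞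
    (fun x => Bundle.TotalSpace.mk' (E →L[ℝ] E →L[ℝ] ℝ)
      (E := fun x : M => TangentSpace 𝓘(ℝ, E) x →L[ℝ] TangentSpace 𝓘(ℝ, E) x →L[ℝ] ℝ) x (κ x))
  κ_self : ∀ (x : M) (v : TangentSpace 𝓘(ℝ, E) x), κ x v v = 0
  /-- `dκ = 0`: at each point, computed in the chart around that point. -/
  closed : ∀ (p : M) (u v w : E),
    extDerivTwo (bilinInChart κ p) (extChartAt 𝓘(ℝ, E) p p) u v w = 0
  calibrated : ∀ (x : M) (v w : TangentSpace 𝓘(ℝ, E) x), g.inner x v w = κ x v (J x w)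

namespace AlmostKahlerStructure

variable {E : Type*} [NormedAddCommGroup E] [NormedSpace ℝ E]
  {M : Type*} [TopologicalSpace M] [ChartedSpace E M] [IsManifold 𝓘(ℝ, E) ∞ M]
  (S : AlmostKahlerStructure E M)

/-- The almost Kähler structure is a Kähler structure if `J` is integrable. -/
def IsKahler : Prop := IsIntegrable S.J

theorem κ_swap (x : M) (v w : TangentSpace 𝓘(ℝ, E) x) : S.κ x v w = -S.κ x w v := by
  have h := S.κ_self x (v + w)
  simp only [map_add, _root_.add_apply, S.κ_self] at h
  linarith

/-- The metric is `J`-invariant (Hermitian). -/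
theorem metric_J (x : M) (v w : TangentSpace 𝓘(ℝ, E) x) :
    S.g.inner x (S.J x v) (S.J x w) = S.g.inner x v w := by
  rw [S.calibrated, S.J_J, map_neg, S.κ_swap, neg_neg, ← S.calibrated, S.g.symm]

theorem nondegenerate (x : M) (v : TangentSpace 𝓘(ℝ, E) x) (h : ∀ w, S.κ x v w = 0) : v = 0 := by
  by_contra hv
  have := S.g.pos x v hv
  rw [S.calibrated, h] at this
  exact lt_irrefl _ this

theorem metric_J_self (x : M) (v : TangentSpace 𝓘(ℝ, E) x) :
    S.g.inner x v (S.J x v) = 0 := by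
  rw [S.calibrated, S.J_J, map_neg, S.κ_self, neg_zero]

/-- The coefficients, in the chart around `p`, of the Levi-Civita connection `∇` of `g`. -/
def leviCivita (p : M) : E → E → E → E :=
  christoffel (bilinInChart S.g.inner p)

/-- The coefficients, in the chart around `p`, of the Hermitian connection `∇ - ½ J ∇J`. -/
def hermitianConnection (p : M) : E → E → E → E :=
  hermitianCoeff (S.leviCivita p) (endInChart S.J p)

/-- The Riemannian curvature tensor `R(u, v, w, z) = g(R(u, v) w, z)` at `p`. It is computed in the
chart around `p`, whose differential at `p` is the canonical identification of `T_pM` with `E`. -/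
def riemannTensor (p : M) (u v w z : TangentSpace 𝓘(ℝ, E) p) : ℝ :=
  S.g.inner p (curvature (E := E) (S.leviCivita p) (extChartAt 𝓘(ℝ, E) p p) u v w) z

/-- The curvature tensor of the Hermitian connection at `p`, with all indices lowered by `g`. -/
def hermitianTensor (p : M) (u v w z : TangentSpace 𝓘(ℝ, E) p) : ℝ :=
  S.g.inner p (curvature (E := E) (S.hermitianConnection p) (extChartAt 𝓘(ℝ, E) p p) u v w) z

/-- The set `𝒫^{1,1}_p(M)` of `J`-invariant planes in `T_pM`. -/
def invariantPlanes (p : M) : Set (Submodule ℝ (TangentSpace 𝓘(ℝ, E) p)) :=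
  {σ | Module.finrank ℝ σ = 2 ∧ ∀ v ∈ σ, S.J p v ∈ σ}

/-- A `J`-invariant plane `σ` is `⟨v, Jv⟩` for some unit vector `v`. -/
theorem exists_unit {p : M} {σ : Submodule ℝ (TangentSpace 𝓘(ℝ, E) p)}
    (hσ : σ ∈ S.invariantPlanes p) :
    ∃ v : TangentSpace 𝓘(ℝ, E) p, S.g.inner p v v = 1 ∧ Submodule.span ℝ {v, S.J p v} = σ := by
  obtain ⟨hdim, hinv⟩ := hσ
  have hne : σ ≠ ⊥ := by
    rintro rfl
    simp at hdim
  obtain ⟨u, huσ, hu⟩ := Submodule.exists_mem_ne_zero_of_ne_bot hne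
  have hpos := S.g.pos p u hu
  set c : ℝ := (Real.sqrt (S.g.inner p u u))⁻¹ with hc
  have hcc : c * c * S.g.inner p u u = 1 := by
    rw [hc, ← mul_inv, Real.mul_self_sqrt hpos.le, inv_mul_cancel₀ hpos.ne']
  have hv1 : S.g.inner p (c • u) (c • u) = 1 := by
    simp only [map_smul, _root_.smul_apply, smul_eq_mul]
    linarith
  refine ⟨c • u, hv1, ?_⟩
  set v := c • u with hv
  have hvσ : v ∈ σ := σ.smul_mem c huσ
  have hfd : FiniteDimensional ℝ σ := Module.finite_of_finrank_eq_succ hdim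
  have hli : LinearIndependent ℝ ![v, S.J p v] := by
    rw [LinearIndependent.pair_iff]
    intro a b hab
    have h1 := congrArg (fun z => S.g.inner p v z) hab
    have h2 := congrArg (fun z => S.g.inner p (S.J p v) z) hab
    simp only [map_add, map_smul, map_zero, smul_eq_mul, S.metric_J_self, hv1] at h1
    simp only [map_add, map_smul, map_zero, smul_eq_mul, S.g.symm p (S.J p v) v,
      S.metric_J_self, S.metric_J, hv1] at h2
    constructor <;> linarith
  have hle : Submodule.span ℝ {v, S.J p v} ≤ σ := by
    rw [Submodule.span_le]
    rintro z (rfl | rfl)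
    · exact hvσ
    · exact hinv v hvσ
  refine Submodule.eq_of_le_of_finrank_eq hle ?_
  have := finrank_span_eq_card hli
  rw [hdim]
  have hr : Set.range ![v, S.J p v] = {v, S.J p v} := by
    simp [Matrix.range_cons, Set.pair_comm]
  rwa [hr] at this

/-- A unit vector `v` with `σ = ⟨v, Jv⟩`. -/
def unitVector {p : M} (σ : S.invariantPlanes p) : TangentSpace 𝓘(ℝ, E) p :=
  (S.exists_unit σ.2).choose

/-- The bisectional curvature `T(v, Jv, w, Jw)` of the planes `σ₁ = ⟨v, Jv⟩` and `σ₂ = ⟨w, Jw⟩`,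
`v` and `w` unit vectors, for a curvature tensor `T` at `p`. It does not depend on the choice of `v`
and `w`, see `bisectional_eq`. -/
def bisectional {p : M} (T : TangentSpace 𝓘(ℝ, E) p → TangentSpace 𝓘(ℝ, E) p →
    TangentSpace 𝓘(ℝ, E) p → TangentSpace 𝓘(ℝ, E) p → ℝ) (σ₁ σ₂ : S.invariantPlanes p) : ℝ :=
  T (S.unitVector σ₁) (S.J p (S.unitVector σ₁)) (S.unitVector σ₂) (S.J p (S.unitVector σ₂))

/-- For a plane `⟨v, Jv⟩` and an alternating bilinear form `b`, the number `b(v, Jv)` does not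
depend on the unit vector `v`. -/
theorem alternating_eq {p : M} (b : LinearMap.BilinForm ℝ (TangentSpace 𝓘(ℝ, E) p))
    (hb : ∀ v, b v v = 0) (v w : TangentSpace 𝓘(ℝ, E) p)
    (hv : S.g.inner p v v = 1) (hw : S.g.inner p w w = 1)
    (h : Submodule.span ℝ {w, S.J p w} = Submodule.span ℝ {v, S.J p v}) :
    b w (S.J p w) = b v (S.J p v) := by
  have hmem : w ∈ Submodule.span ℝ {v, S.J p v} := by
    rw [← h]
    exact Submodule.subset_span (by simp)
  obtain ⟨a, c, rfl⟩ := Submodule.mem_span_pair.1 hmem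
  have hsw : b (S.J p v) v = -b v (S.J p v) := by
    have := hb (v + S.J p v)
    simp only [map_add, LinearMap.add_apply, hb] at this
    linarith
  simp only [map_add, map_smul, _root_.add_apply, _root_.smul_apply,
    smul_eq_mul, S.metric_J_self, S.metric_J, S.g.symm p (S.J p v) v, hv] at hw
  simp only [map_add, map_smul, LinearMap.add_apply, LinearMap.smul_apply, smul_eq_mul, S.J_J,
    smul_neg, map_neg, hb, hsw]
  linear_combination (b v (S.J p v)) * hw

/-- The bisectional curvature, computed with arbitrary unit vectors spanning the planes, for a
tensor that is alternating in the first two and in the last two arguments. -/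
theorem bisectional_eq {p : M}
    (T : TangentSpace 𝓘(ℝ, E) p →ₗ[ℝ] TangentSpace 𝓘(ℝ, E) p →ₗ[ℝ]
      LinearMap.BilinForm ℝ (TangentSpace 𝓘(ℝ, E) p))
    (h₁ : ∀ v, T v v = 0) (h₂ : ∀ u v w, T u v w w = 0) (σ₁ σ₂ : S.invariantPlanes p)
    (v w : TangentSpace 𝓘(ℝ, E) p) (hv : S.g.inner p v v = 1) (hw : S.g.inner p w w = 1)
    (hvσ : Submodule.span ℝ {v, S.J p v} = (σ₁ : Submodule ℝ (TangentSpace 𝓘(ℝ, E) p)))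
    (hwσ : Submodule.span ℝ {w, S.J p w} = (σ₂ : Submodule ℝ (TangentSpace 𝓘(ℝ, E) p))) :
    S.bisectional (fun a b c d => T a b c d) σ₁ σ₂ = T v (S.J p v) w (S.J p w) := by
  have e₁ := (S.exists_unit σ₁.2).choose_spec
  have e₂ := (S.exists_unit σ₂.2).choose_spec
  change T (S.unitVector σ₁) (S.J p (S.unitVector σ₁)) (S.unitVector σ₂)
    (S.J p (S.unitVector σ₂)) = _
  rw [S.alternating_eq (T (S.unitVector σ₁) (S.J p (S.unitVector σ₁))) (h₂ _ _) w
    (S.unitVector σ₂) hw e₂.1 (e₂.2.trans hwσ.symm)]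
  let B : LinearMap.BilinForm ℝ (TangentSpace 𝓘(ℝ, E) p) :=
    LinearMap.mk₂ ℝ (fun a b => T a b w (S.J p w)) (by simp) (by simp) (by simp) (by simp)
  have hB : ∀ a, B a a = 0 := fun a => by simp [B, h₁]
  exact S.alternating_eq B hB v (S.unitVector σ₁) hv e₁.1 (e₁.2.trans hvσ.symm)

/-- The holomorphic bisectional curvature `K[p](σ₁, σ₂)`, that of the Levi-Civita connection. -/
def riemannianBisectional (p : M) (σ₁ σ₂ : S.invariantPlanes p) : ℝ :=
  S.bisectional (S.riemannTensor p) σ₁ σ₂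

/-- The Hermitian bisectional curvature, that of the Hermitian connection. -/
def hermitianBisectional (p : M) (σ₁ σ₂ : S.invariantPlanes p) : ℝ :=
  S.bisectional (S.hermitianTensor p) σ₁ σ₂

end AlmostKahlerStructure

end AlmostKahler

end

/-!
The proof is local. Put `P = ∇J`. Since `∇̃ = ∇ - ½ J P`, the curvatures are related by
`R̃(u, v) = ½ (R(u, v) - J R(u, v) J) - ¼ [P_u, P_v]` (`curvature_hermitianCoeff`). The
endomorphisms `P_u` are skew and anticommute with `J`. As the fundamental form is closed, the structure is
quasi-Kähler, `P_{Ju} = -J P_u` (`IsAlmostKahlerAt.covDerivEnd_J_left`); hence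
`[P_v, P_{Jv}] = 2 J P_v²`, and
`R̃(v, Jv, w, Jw) = R(v, Jv, w, Jw) + ½ |P_v w|²`
(`IsAlmostKahlerAt.metric_curvature_hermitianCoeff`). If the two bisectional curvatures agree, then
`P = 0`. Since `∇` is torsion-free, `∇J = 0` makes the Nijenhuis tensor vanish
(`IsAlmostKahlerAt.nijenhuis_eq_zero`).

These computations are carried out on `E`, for the coordinate expressions of `g` and `J` near the
centre of a chart. The rest shows that the expressions of smooth tensor fields are smooth, that they
coincide with the fields at the centre, and that the Lie bracket can be computed in the chart.
-/

noncomputable section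

namespace AlmostKahler

open Filter Topology

-- Needed for the normed space structure on trilinear maps such as `fderiv ℝ G y`.
set_option maxSynthPendingDepth 5

/-! ### Connections and curvature in coordinates -/

section Coordinates

variable {E : Type*} [NormedAddCommGroup E] [NormedSpace ℝ E]

theorem hasFDerivAt_apply {F : Type*} [NormedAddCommGroup F] [NormedSpace ℝ F]
    {A : E → E →L[ℝ] F} {y : E} (hA : DifferentiableAt ℝ A y) (b : E) :
    HasFDerivAt (fun z => A z b) ((fderiv ℝ A y).flip b) y := by
  simpa using hA.hasFDerivAt.clm_apply (hasFDerivAt_const b y)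

theorem hasFDerivAt_apply_apply {C : E → E →L[ℝ] E →L[ℝ] E} {y : E}
    (hC : DifferentiableAt ℝ C y) (b c : E) :
    HasFDerivAt (fun z => C z b c) (((fderiv ℝ C y).flip b).flip c) y := by
  refine ((hC.hasFDerivAt.clm_apply (hasFDerivAt_const b y)).clm_apply
    (hasFDerivAt_const c y)).congr_fderiv ?_
  ext; simp

/-- The Christoffel symbols of `christoffel` as a field of continuous bilinear maps, so that the
calculus of derivatives of continuous linear maps applies to them. -/
def christoffelCLM (G : E → E →L[ℝ] E →L[ℝ] ℝ) (y : E) : E →L[ℝ] E →L[ℝ] E :=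
  ContinuousLinearMap.compL ℝ E (E →L[ℝ] ℝ) E (G y).inverse ∘L
    ((1 / 2 : ℝ) • (fderiv ℝ G y + (fderiv ℝ G y).flip -
      (ContinuousLinearMap.flipₗᵢ ℝ E E ℝ : (E →L[ℝ] E →L[ℝ] ℝ) →L[ℝ] E →L[ℝ] E →L[ℝ] ℝ) ∘L
        (fderiv ℝ G y).flip))

theorem christoffelCLM_apply (G : E → E →L[ℝ] E →L[ℝ] ℝ) (y u v : E) :
    christoffelCLM G y u v = christoffel G y u v := by
  simp [christoffelCLM, christoffel]

theorem christoffelCLM_eq (G : E → E →L[ℝ] E →L[ℝ] ℝ) :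
    (fun x a b => christoffelCLM G x a b) = christoffel G := by
  funext x a b
  exact christoffelCLM_apply G x a b

theorem contDiffAt_christoffelCLM [FiniteDimensional ℝ E] {G : E → E →L[ℝ] E →L[ℝ] ℝ} {y : E}
    (hG : ContDiffAt ℝ 2 G y) (hpos : ∀ a, a ≠ 0 → 0 < G y a a) :
    ContDiffAt ℝ 1 (christoffelCLM G) y := by
  have : CompleteSpace E := FiniteDimensional.complete ℝ E
  have hinj : Function.Injective (G y) := by
    rw [injective_iff_map_eq_zero]
    intro a ha
    by_contra hne
    simpa [ha] using hpos a hne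
  have hdim : Module.finrank ℝ E = Module.finrank ℝ (E →L[ℝ] ℝ) := by
    rw [← (LinearMap.toContinuousLinearMap (𝕜 := ℝ) (E := E) (F' := ℝ)).finrank_eq]
    exact (Subspace.dual_finrank_eq (K := ℝ) (V := E)).symm
  let e : E ≃L[ℝ] (E →L[ℝ] ℝ) :=
    (LinearEquiv.ofInjectiveOfFinrankEq (G y : E →ₗ[ℝ] (E →L[ℝ] ℝ)) hinj
      hdim).toContinuousLinearEquiv
  have he : (e : E →L[ℝ] (E →L[ℝ] ℝ)) = G y := rfl
  have hinv : ContDiffAt ℝ 1 (fun z => (G z).inverse) y := by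
    have h := contDiffAt_map_inverse (𝕜 := ℝ) (n := 1) e
    rw [he] at h
    exact h.comp y (hG.of_le (by norm_num))
  have hD : ContDiffAt ℝ 1 (fderiv ℝ G) y := hG.fderiv_right (by norm_num)
  have hF : ContDiffAt ℝ 1 (fun z => (fderiv ℝ G z).flip) y :=
    (ContinuousLinearMap.flipₗᵢ ℝ E E (E →L[ℝ] ℝ)).contDiff.contDiffAt.comp y hD
  unfold christoffelCLM
  refine ContDiffAt.clm_comp ?_ (((hD.add hF).sub
    (contDiffAt_const.clm_comp hF)).const_smul _)
  exact (ContinuousLinearMap.compL ℝ E (E →L[ℝ] ℝ) E).contDiff.contDiffAt.comp y hinv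

/-- Differentiating `J² = -1` shows that the derivatives of `J` anticommute with `J`. -/
theorem fderiv_anticomm {J : E → E →L[ℝ] E} {y : E} (hJ : DifferentiableAt ℝ J y)
    (hJJ : ∀ᶠ z in 𝓝 y, ∀ v, J z (J z v) = -v) (a b : E) :
    fderiv ℝ J y a (J y b) = -J y (fderiv ℝ J y a b) := by
  have h1 : HasFDerivAt (fun z => J z (J z b))
      (((J y).comp ((fderiv ℝ J y).flip b)) + (fderiv ℝ J y).flip (J y b)) y :=
    hJ.hasFDerivAt.clm_apply (hasFDerivAt_apply hJ b)
  have h2 : HasFDerivAt (fun z => J z (J z b)) (0 : E →L[ℝ] E) y :=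
    (hasFDerivAt_const (-b) y).congr_of_eventuallyEq (hJJ.mono fun z hz => hz b)
  have h3 := congrArg (fun L => L a) (h1.unique h2)
  simp at h3
  exact eq_neg_of_add_eq_zero_right h3

/-- The curvature `R̃` of `∇ - ½ J ∇J` is `½ (R - J R J) - ¼ [∇J, ∇J]`, for any connection `∇` and
any almost complex structure `J`. The second derivatives of `J` enter through the skew part
`[R(u, v), J]` of `∇²J` only. -/
theorem curvature_hermitianCoeff {C : E → E →L[ℝ] E →L[ℝ] E} {J : E → E →L[ℝ] E} {y : E}
    (hC : DifferentiableAt ℝ C y) (hJ : ContDiffAt ℝ 2 J y)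
    (hJJ : ∀ᶠ z in 𝓝 y, ∀ v, J z (J z v) = -v) (u v w : E) :
    curvature (hermitianCoeff (fun z a b => C z a b) J) y u v w =
      (1 / 2 : ℝ) • (curvature (fun z a b => C z a b) y u v w
        - J y (curvature (fun z a b => C z a b) y u v (J y w)))
      - (1 / 4 : ℝ) • (covDerivEnd (fun z a b => C z a b) J y u
            (covDerivEnd (fun z a b => C z a b) J y v w)
          - covDerivEnd (fun z a b => C z a b) J y v
            (covDerivEnd (fun z a b => C z a b) J y u w)) := by
  have hJ1 : DifferentiableAt ℝ J y := hJ.differentiableAt (by norm_num)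
  have hJ2 : DifferentiableAt ℝ (fderiv ℝ J) y :=
    (hJ.fderiv_right (m := 1) (by norm_num)).differentiableAt (by norm_num)
  have hsymm : IsSymmSndFDerivAt ℝ J y := hJ.isSymmSndFDerivAt (by simp)
  have hJy := hJJ.self_of_nhds
  have hDJ := fderiv_anticomm hJ1 hJJ
  have hΓ := hasFDerivAt_apply_apply hC
  have key : ∀ a b c, fderiv ℝ (fun z => hermitianCoeff (fun z a b => C z a b) J z b c) y a =
      (1 / 2 : ℝ) • (fderiv ℝ C y a b c - fderiv ℝ J y a (C y b (J y c))
        - J y (fderiv ℝ C y a b (J y c)) - J y (C y b (fderiv ℝ J y a c))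
        - fderiv ℝ J y a (fderiv ℝ J y b c) - J y (fderiv ℝ (fderiv ℝ J) y a b c)) := by
    intro a b c
    -- `J² = -1` near `y` turns the coefficients into `½ (Γ - J Γ J - J DJ)`, which shortens the
    -- derivative.
    have h0 : (fun z => hermitianCoeff (fun z a b => C z a b) J z b c) =ᶠ[𝓝 y]
        fun z => (1 / 2 : ℝ) • (C z b c - J z (C z b (J z c)) - J z (fderiv ℝ J z b c)) := by
      filter_upwards [hJJ] with z hz
      simp only [hermitianCoeff, covDerivEnd, map_add, map_sub, hz]
      module
    have h2 := hasFDerivAt_apply hJ1 c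
    have h3 := hJ1.hasFDerivAt.clm_apply
      ((hC.hasFDerivAt.clm_apply (hasFDerivAt_const b y)).clm_apply h2)
    have h4 := hJ1.hasFDerivAt.clm_apply
      ((hJ2.hasFDerivAt.clm_apply (hasFDerivAt_const b y)).clm_apply (hasFDerivAt_const c y))
    have h5 := (((hΓ b c).sub h3).sub h4).const_smul (1 / 2 : ℝ)
    rw [(h5.congr_of_eventuallyEq h0).fderiv]
    simp
    module
  simp only [curvature, key, (hΓ _ _).fderiv, hsymm.eq v u]
  simp only [hermitianCoeff, covDerivEnd, map_add, map_sub, map_smul, map_neg, hJy, hDJ,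
    ContinuousLinearMap.flip_apply]
  module

theorem covDerivEnd_lin_left (G : E → E →L[ℝ] E →L[ℝ] ℝ) (J : E → E →L[ℝ] E) (y : E) (a b : ℝ)
    (u v w : E) : covDerivEnd (christoffel G) J y (a • u + b • v) w =
      a • covDerivEnd (christoffel G) J y u w + b • covDerivEnd (christoffel G) J y v w := by
  simp only [← christoffelCLM_eq, covDerivEnd, map_add, map_smul, _root_.add_apply,
    _root_.smul_apply]
  module

theorem covDerivEnd_lin_right (G : E → E →L[ℝ] E →L[ℝ] ℝ) (J : E → E →L[ℝ] E) (y : E) (a b : ℝ)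
    (u v w : E) : covDerivEnd (christoffel G) J y u (a • v + b • w) =
      a • covDerivEnd (christoffel G) J y u v + b • covDerivEnd (christoffel G) J y u w := by
  simp only [← christoffelCLM_eq, covDerivEnd, map_add, map_smul]
  module

/-! ### The bisectional curvatures of an almost Kähler structure, in coordinates -/

/-- The coordinate expressions `G` of the metric and `J` of the almost complex structure form an
almost Kähler structure near `y`. The fundamental form is `G(J ·, ·)`; it is required to be closed
at `y` only, since a condition of first order at `y` is all that the argument at `y` uses. -/
structure IsAlmostKahlerAt (G : E → E →L[ℝ] E →L[ℝ] ℝ) (J : E → E →L[ℝ] E) (y : E) : Prop where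
  contDiffAt_metric : ContDiffAt ℝ 2 G y
  contDiffAt_J : ContDiffAt ℝ 2 J y
  pos : ∀ᶠ z in 𝓝 y, ∀ a, a ≠ 0 → 0 < G z a a
  symm : ∀ᶠ z in 𝓝 y, ∀ a b, G z a b = G z b a
  J_J : ∀ᶠ z in 𝓝 y, ∀ a, J z (J z a) = -a
  skew : ∀ᶠ z in 𝓝 y, ∀ a b, G z (J z a) b = -G z a (J z b)
  closed : ∀ u v w, extDerivTwo (fun z => (G z).comp (J z)) y u v w = 0

namespace IsAlmostKahlerAt

variable {G : E → E →L[ℝ] E →L[ℝ] ℝ} {J : E → E →L[ℝ] E} {y : E}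

theorem fderiv_metric_symm (h : IsAlmostKahlerAt G J y) :
    ∀ᶠ z in 𝓝 y, ∀ u a b, fderiv ℝ G z u a b = fderiv ℝ G z u b a := by
  have hd : ∀ᶠ z in 𝓝 y, DifferentiableAt ℝ G z :=
    (h.contDiffAt_metric.eventually (by simp)).mono
      fun z hz => hz.differentiableAt (by norm_num)
  filter_upwards [h.symm.eventually_nhds, hd] with z hz hG u a b
  have e : G =ᶠ[𝓝 z] fun x => (G x).flip := hz.mono fun x hx => by ext a b; exact hx a b
  have h2 : HasFDerivAt (fun x => (G x).flip) _ z :=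
    ((ContinuousLinearMap.flipₗᵢ ℝ E E ℝ).toContinuousLinearEquiv : (E →L[ℝ] E →L[ℝ] ℝ) →L[ℝ]
      E →L[ℝ] E →L[ℝ] ℝ).hasFDerivAt.comp z hG.hasFDerivAt
  have h3 := congrArg (fun L => L u a b) (hG.hasFDerivAt.unique (h2.congr_of_eventuallyEq e))
  simpa using h3

variable [FiniteDimensional ℝ E]

theorem fderiv_metric_eq (h : IsAlmostKahlerAt G J y) :
    ∀ᶠ z in 𝓝 y, ∀ u v w, fderiv ℝ G z u v w =
      G z (christoffelCLM G z u v) w + G z v (christoffelCLM G z u w) := by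
  filter_upwards [h.fderiv_metric_symm, h.pos, h.symm] with z h1 h2 h3 u v w
  simp only [christoffelCLM_apply]
  exact fderiv_metric G z u v w h2 h3 h1

theorem differentiableAt_christoffelCLM (h : IsAlmostKahlerAt G J y) :
    DifferentiableAt ℝ (christoffelCLM G) y :=
  (contDiffAt_christoffelCLM h.contDiffAt_metric h.pos.self_of_nhds).differentiableAt (by norm_num)

omit [FiniteDimensional ℝ E] in
theorem christoffelCLM_symm (h : IsAlmostKahlerAt G J y) (u v : E) :
    christoffelCLM G y u v = christoffelCLM G y v u := by
  simp only [christoffelCLM_apply]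
  exact christoffel_symm G y u v h.fderiv_metric_symm.self_of_nhds

/-- The curvature operators of the Levi-Civita connection are skew: the second derivatives of `G`
are symmetric, and the connection is metric near `y`. -/
theorem metric_curvature_skew (h : IsAlmostKahlerAt G J y) (u v w z : E) :
    G y (curvature (fun x a b => christoffelCLM G x a b) y u v w) z =
      -G y (curvature (fun x a b => christoffelCLM G x a b) y u v z) w := by
  have hC := h.differentiableAt_christoffelCLM
  have hG := h.contDiffAt_metric.differentiableAt (by norm_num)
  have hG2 : DifferentiableAt ℝ (fderiv ℝ G) y :=
    (h.contDiffAt_metric.fderiv_right (m := 1) (by norm_num)).differentiableAt (by norm_num)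
  have hsymm : IsSymmSndFDerivAt ℝ G y := h.contDiffAt_metric.isSymmSndFDerivAt (by simp)
  have hΓ := hasFDerivAt_apply_apply hC
  have key : ∀ a b, fderiv ℝ (fderiv ℝ G) y a b w z =
      fderiv ℝ G y a (christoffelCLM G y b w) z + G y (fderiv ℝ (christoffelCLM G) y a b w) z
      + (fderiv ℝ G y a w (christoffelCLM G y b z)
        + G y w (fderiv ℝ (christoffelCLM G) y a b z)) := by
    intro a b
    have h1 := ((hG2.hasFDerivAt.clm_apply (hasFDerivAt_const b y)).clm_apply
      (hasFDerivAt_const w y)).clm_apply (hasFDerivAt_const z y)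
    have h2 := ((hG.hasFDerivAt.clm_apply (hΓ b w)).clm_apply (hasFDerivAt_const z y)).add
      ((hG.hasFDerivAt.clm_apply (hasFDerivAt_const w y)).clm_apply (hΓ b z))
    have h3 := h1.unique (h2.congr_of_eventuallyEq
      (h.fderiv_metric_eq.mono fun x hx => hx b w z))
    have h4 := congrArg (fun L => L a) h3
    simp at h4
    linarith
  have hs := h.symm.self_of_nhds
  have h1 := key u v
  have h2 := key v u
  rw [hsymm.eq u v] at h1
  simp only [h.fderiv_metric_eq.self_of_nhds] at h1 h2
  simp only [curvature, (hΓ _ _).fderiv, ContinuousLinearMap.flip_apply, map_add, map_sub,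
    _root_.add_apply, _root_.sub_apply]
  rw [hs _ w, hs _ w, hs _ w, hs _ w]
  linarith

omit [FiniteDimensional ℝ E] in
theorem differentiableAt_J (h : IsAlmostKahlerAt G J y) : DifferentiableAt ℝ J y :=
  h.contDiffAt_J.differentiableAt (by norm_num)

omit [FiniteDimensional ℝ E] in
theorem covDerivEnd_J (h : IsAlmostKahlerAt G J y) (u w : E) :
    covDerivEnd (christoffel G) J y u (J y w) = -J y (covDerivEnd (christoffel G) J y u w) := by
  rw [← christoffelCLM_eq]
  simp only [covDerivEnd, fderiv_anticomm h.differentiableAt_J h.J_J, h.J_J.self_of_nhds,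
    map_add, map_sub, map_neg]
  abel

/-- `∇_u J` is skew, because `J` is skew and `∇` is metric. -/
theorem covDerivEnd_skew (h : IsAlmostKahlerAt G J y) (u v w : E) :
    G y (covDerivEnd (christoffel G) J y u v) w =
      -G y v (covDerivEnd (christoffel G) J y u w) := by
  have hJ := h.differentiableAt_J
  have hG := h.contDiffAt_metric.differentiableAt (by norm_num)
  have hJv := hasFDerivAt_apply hJ
  have h1 := (hG.hasFDerivAt.clm_apply (hJv v)).clm_apply (hasFDerivAt_const w y)
  have h2 := ((hG.hasFDerivAt.clm_apply (hasFDerivAt_const v y)).clm_apply (hJv w)).neg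
  have h3 := congrArg (fun L => L u) (h1.unique (h2.congr_of_eventuallyEq
    (h.skew.mono fun x hx => hx v w)))
  simp [h.fderiv_metric_eq.self_of_nhds] at h3
  rw [← christoffelCLM_eq]
  have hs := h.skew.self_of_nhds
  simp only [covDerivEnd, map_add, map_sub, _root_.add_apply, _root_.sub_apply, hs] at h3 ⊢
  linarith

/-- The cyclic sum of `g((∇_u J) v, w)` is the exterior derivative of the fundamental form. -/
theorem covDerivEnd_cyclic (h : IsAlmostKahlerAt G J y) (u v w : E) :
    G y (covDerivEnd (christoffel G) J y u v) w + G y (covDerivEnd (christoffel G) J y v w) u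
      + G y (covDerivEnd (christoffel G) J y w u) v = 0 := by
  have hJ := h.differentiableAt_J
  have hG := h.contDiffAt_metric.differentiableAt (by norm_num)
  have h1 := (hG.hasFDerivAt.clm_comp hJ.hasFDerivAt).fderiv
  have h2 := h.closed u v w
  unfold extDerivTwo at h2
  rw [h1] at h2
  simp [h.fderiv_metric_eq.self_of_nhds] at h2
  rw [← christoffelCLM_eq]
  have hs := h.skew.self_of_nhds
  have hsy := h.symm.self_of_nhds
  simp only [covDerivEnd, map_add, map_sub, _root_.add_apply, _root_.sub_apply, hs] at h2 ⊢
  rw [h.christoffelCLM_symm v u, h.christoffelCLM_symm u w, h.christoffelCLM_symm w v] at h2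
  have e1 := hs w (christoffelCLM G y u v)
  have e2 := hs v (christoffelCLM G y w u)
  have e3 := hs u (christoffelCLM G y v w)
  rw [hsy] at e1 e2 e3
  linarith

/-- An almost Kähler structure is quasi-Kähler: `∇_{Ju} J = -J ∇_u J`. This is the vanishing of the
components of type `(2, 1)` and `(1, 2)` of the exterior derivative of the fundamental form. -/
theorem covDerivEnd_J_left (h : IsAlmostKahlerAt G J y) (u v : E) :
    covDerivEnd (christoffel G) J y (J y u) v = -J y (covDerivEnd (christoffel G) J y u v) := by
  have hs := h.skew.self_of_nhds
  have hJJ := h.J_J.self_of_nhds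
  have hF : ∀ a b c, G y (covDerivEnd (christoffel G) J y a (J y b)) c =
      G y (covDerivEnd (christoffel G) J y a b) (J y c) := by
    intro a b c
    rw [h.covDerivEnd_J, map_neg, _root_.neg_apply, hs, neg_neg]
  -- With `S(a, b, c)` the cyclic sum of `g((∇_a J) b, c)`, twice the left-hand side below is
  -- `S(u, v, w) + S(Ju, Jv, w) + S(Ju, v, Jw) - S(u, Jv, Jw)`.
  have key : ∀ w, G y (covDerivEnd (christoffel G) J y (J y u) (J y v)
      + covDerivEnd (christoffel G) J y u v) w = 0 := by
    intro w
    have c1 := h.covDerivEnd_cyclic u v w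
    have c2 := h.covDerivEnd_cyclic (J y u) (J y v) w
    have c3 := h.covDerivEnd_cyclic (J y u) v (J y w)
    have c4 := h.covDerivEnd_cyclic u (J y v) (J y w)
    simp only [hF, hJJ, map_neg] at c1 c2 c3 c4
    simp only [hF, map_add, _root_.add_apply]
    linarith
  have h0 : covDerivEnd (christoffel G) J y (J y u) (J y v)
      + covDerivEnd (christoffel G) J y u v = 0 := by
    by_contra hne
    exact (h.pos.self_of_nhds _ hne).ne' (key _)
  rw [h.covDerivEnd_J] at h0
  have h1 := congrArg (J y) h0
  simp only [map_add, map_neg, hJJ, neg_neg, map_zero] at h1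
  exact eq_neg_of_add_eq_zero_left h1

/-- The difference of the Hermitian and the Riemannian bisectional curvature is `½ |(∇_v J) w|²`:
in the formula for `R̃(v, Jv)`, the curvature terms combine to `R(v, Jv)`, and the commutator
`[∇_v J, ∇_{Jv} J]` is `2 J (∇_v J)²` because `∇_{Jv} J = -J ∇_v J`. -/
theorem metric_curvature_hermitianCoeff (h : IsAlmostKahlerAt G J y) (v w : E) :
    G y (curvature (hermitianCoeff (christoffel G) J) y v (J y v) w) (J y w) =
      G y (curvature (christoffel G) y v (J y v) w) (J y w)
        + 1 / 2 * G y (covDerivEnd (christoffel G) J y v w)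
            (covDerivEnd (christoffel G) J y v w) := by
  have hs := h.skew.self_of_nhds
  have hJJ := h.J_J.self_of_nhds
  have hR := fun a b => h.metric_curvature_skew v (J y v) a b
  have hH := curvature_hermitianCoeff h.differentiableAt_christoffelCLM h.contDiffAt_J h.J_J
    v (J y v) w
  rw [christoffelCLM_eq] at hR hH
  have hneg : ∀ a b, covDerivEnd (christoffel G) J y a (-b) =
      -covDerivEnd (christoffel G) J y a b := by
    intro a b
    rw [← christoffelCLM_eq]
    simp only [covDerivEnd, map_neg]
    abel
  rw [hH]
  simp only [h.covDerivEnd_J_left, hneg, h.covDerivEnd_J, map_sub, map_smul, map_neg,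
    _root_.sub_apply, _root_.smul_apply, _root_.neg_apply, smul_eq_mul, hs, hJJ,
    h.covDerivEnd_skew v (covDerivEnd (christoffel G) J y v w) w]
  rw [hR (J y w) w]
  ring

theorem covDerivEnd_eq_zero (h : IsAlmostKahlerAt G J y) {v w : E}
    (hK : G y (curvature (christoffel G) y v (J y v) w) (J y w) =
      G y (curvature (hermitianCoeff (christoffel G) J) y v (J y v) w) (J y w)) :
    covDerivEnd (christoffel G) J y v w = 0 := by
  by_contra hne
  have := h.pos.self_of_nhds _ hne
  have := h.metric_curvature_hermitianCoeff v w
  linarith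

/-- The vanishing of `(∇_v J) w` depends only on the complex lines spanned by `v` and `w`. -/
theorem covDerivEnd_eq_zero_of_mem_span (h : IsAlmostKahlerAt G J y) {v w v' w' : E}
    (hvw : covDerivEnd (christoffel G) J y v w = 0)
    (hv : v' ∈ Submodule.span ℝ {v, J y v}) (hw : w' ∈ Submodule.span ℝ {w, J y w}) :
    covDerivEnd (christoffel G) J y v' w' = 0 := by
  obtain ⟨a, b, rfl⟩ := Submodule.mem_span_pair.1 hv
  obtain ⟨c, d, rfl⟩ := Submodule.mem_span_pair.1 hw
  simp [covDerivEnd_lin_left, covDerivEnd_lin_right, h.covDerivEnd_J_left, h.covDerivEnd_J, hvw]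

omit [FiniteDimensional ℝ E] in
/-- If `∇J = 0`, the Nijenhuis tensor vanishes: by `DJ = J Γ - Γ J` it is an expression in the
Christoffel symbols `Γ` that cancels by their symmetry. -/
theorem nijenhuis_eq_zero (h : IsAlmostKahlerAt G J y)
    (hP : ∀ v w, covDerivEnd (christoffel G) J y v w = 0) {X Y : E → E}
    (hX : DifferentiableAt ℝ X y) (hY : DifferentiableAt ℝ Y y) :
    VectorField.lieBracket ℝ (fun z => J z (X z)) (fun z => J z (Y z)) y
      - J y (VectorField.lieBracket ℝ (fun z => J z (X z)) Y y)
      - J y (VectorField.lieBracket ℝ X (fun z => J z (Y z)) y)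
      - VectorField.lieBracket ℝ X Y y = 0 := by
  have hJ := h.differentiableAt_J
  have hJJ := h.J_J.self_of_nhds
  have hD : ∀ a b, fderiv ℝ J y a b =
      J y (christoffelCLM G y a b) - christoffelCLM G y a (J y b) := by
    intro a b
    have := hP a b
    rw [← christoffelCLM_eq, covDerivEnd] at this
    rw [sub_eq_zero] at this
    rw [← this]
    abel
  simp only [VectorField.lieBracket, (hJ.hasFDerivAt.clm_apply hX.hasFDerivAt).fderiv,
    (hJ.hasFDerivAt.clm_apply hY.hasFDerivAt).fderiv]
  simp only [_root_.add_apply, ContinuousLinearMap.flip_apply, ContinuousLinearMap.comp_apply,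
    hD, map_add, map_sub, hJJ]
  rw [h.christoffelCLM_symm (J y (Y y)) (X y), h.christoffelCLM_symm (Y y) (J y (X y)),
    h.christoffelCLM_symm (Y y) (X y), h.christoffelCLM_symm (J y (Y y)) (J y (X y))]
  abel

end IsAlmostKahlerAt
end Coordinates

/-! ### Tensor fields in the chart around a point -/

section Charts

variable {E : Type*} [NormedAddCommGroup E] [NormedSpace ℝ E]
  {M : Type*} [TopologicalSpace M] [ChartedSpace E M]

/-- The differential at `y` of the inverse of the chart `φ` around `p`. -/
def tangentFromChart (p : M) (y : E) :
    E →L[ℝ] TangentSpace 𝓘(ℝ, E) ((extChartAt 𝓘(ℝ, E) p).symm y) :=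
  mfderiv 𝓘(ℝ, E) 𝓘(ℝ, E) (extChartAt 𝓘(ℝ, E) p).symm y

/-- The differential at `φ⁻¹(y)` of the chart `φ` around `p`. -/
def tangentToChart (p : M) (y : E) :
    TangentSpace 𝓘(ℝ, E) ((extChartAt 𝓘(ℝ, E) p).symm y) →L[ℝ] E :=
  mfderiv 𝓘(ℝ, E) 𝓘(ℝ, E) (extChartAt 𝓘(ℝ, E) p) ((extChartAt 𝓘(ℝ, E) p).symm y)

theorem bilinInChart_apply
    (B : ∀ x : M, TangentSpace 𝓘(ℝ, E) x →L[ℝ] TangentSpace 𝓘(ℝ, E) x →L[ℝ] ℝ)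
    (p : M) (y v w : E) :
    bilinInChart B p y v w =
      B ((extChartAt 𝓘(ℝ, E) p).symm y) (tangentFromChart p y v) (tangentFromChart p y w) := rfl

theorem endInChart_apply (J : ∀ x : M, TangentSpace 𝓘(ℝ, E) x →L[ℝ] TangentSpace 𝓘(ℝ, E) x)
    (p : M) (y w : E) :
    endInChart J p y w = tangentToChart p y
      (J ((extChartAt 𝓘(ℝ, E) p).symm y) (tangentFromChart p y w)) := rfl

variable [IsManifold 𝓘(ℝ, E) ∞ M]

theorem isManifold_one : IsManifold 𝓘(ℝ, E) 1 M := IsManifold.of_le (n := ∞) (by simp)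

theorem isManifold_two : IsManifold 𝓘(ℝ, E) 2 M :=
  IsManifold.of_le (n := ∞) (WithTop.coe_le_coe.2 (le_top : (2 : ℕ∞) ≤ ⊤))

theorem tangentToChart_tangentFromChart {p : M} {y : E}
    (hy : y ∈ (extChartAt 𝓘(ℝ, E) p).target) (v : E) :
    tangentToChart p y (tangentFromChart p y v) = v := by
  have := isManifold_one (E := E) (M := M)
  have h := mfderiv_extChartAt_comp_mfderivWithin_extChartAt_symm (I := 𝓘(ℝ, E)) hy
  rw [modelWithCornersSelf_coe, Set.range_id, mfderivWithin_univ] at h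
  exact congrArg (fun L : E →L[ℝ] E => L v) h

theorem tangentFromChart_tangentToChart {p : M} {y : E}
    (hy : y ∈ (extChartAt 𝓘(ℝ, E) p).target)
    (v : TangentSpace 𝓘(ℝ, E) ((extChartAt 𝓘(ℝ, E) p).symm y)) :
    tangentFromChart p y (tangentToChart p y v) = v := by
  have := isManifold_one (E := E) (M := M)
  have h := mfderivWithin_extChartAt_symm_comp_mfderiv_extChartAt (I := 𝓘(ℝ, E)) hy
  rw [modelWithCornersSelf_coe, Set.range_id, mfderivWithin_univ] at h
  exact congrArg (fun L : E →L[ℝ] E => L v) h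

theorem tangentFromChart_self (p : M) (v : E) :
    tangentFromChart p (extChartAt 𝓘(ℝ, E) p p) v = v := by
  have := isManifold_one (E := E) (M := M)
  have h := mfderivWithin_range_extChartAt_symm (I := 𝓘(ℝ, E)) (x := p)
  rw [modelWithCornersSelf_coe, Set.range_id, mfderivWithin_univ] at h
  exact congrArg (fun L : E →L[ℝ] E => L v) h

theorem tangentToChart_self (p : M) (v : E) :
    tangentToChart p (extChartAt 𝓘(ℝ, E) p p) v = v := by
  have h := tangentToChart_tangentFromChart (mem_extChartAt_target (I := 𝓘(ℝ, E)) p) v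
  rwa [tangentFromChart_self] at h

theorem bilinInChart_self
    (B : ∀ x : M, TangentSpace 𝓘(ℝ, E) x →L[ℝ] TangentSpace 𝓘(ℝ, E) x →L[ℝ] ℝ) (p : M) :
    bilinInChart B p (extChartAt 𝓘(ℝ, E) p p) = B p := by
  have key : ∀ x, x = p → ∀ v w : E, (B x : E →L[ℝ] E →L[ℝ] ℝ) v w = B p v w := by
    rintro _ rfl v w
    rfl
  ext v w
  refine Eq.trans ?_ (key _ (extChartAt_to_inv (I := 𝓘(ℝ, E)) p) v w)
  exact congrArg₂ (fun a b : E =>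
    (B ((extChartAt 𝓘(ℝ, E) p).symm (extChartAt 𝓘(ℝ, E) p p)) : E →L[ℝ] E →L[ℝ] ℝ) a b)
    (tangentFromChart_self p v) (tangentFromChart_self p w)

theorem endInChart_self (J : ∀ x : M, TangentSpace 𝓘(ℝ, E) x →L[ℝ] TangentSpace 𝓘(ℝ, E) x)
    (p : M) : endInChart J p (extChartAt 𝓘(ℝ, E) p p) = J p := by
  have key : ∀ x, x = p → ∀ v : E, (J x : E →L[ℝ] E) v = J p v := by
    rintro _ rfl v
    rfl
  ext v
  refine Eq.trans ?_ (key _ (extChartAt_to_inv (I := 𝓘(ℝ, E)) p) v)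
  refine (tangentToChart_self p _).trans ?_
  exact congrArg (J ((extChartAt 𝓘(ℝ, E) p).symm (extChartAt 𝓘(ℝ, E) p p)) : E →L[ℝ] E)
    (tangentFromChart_self p v)

/-- The coordinate vector fields of the chart around `p` are smooth on its source. -/
theorem contMDiffAt_symmL {p x : M} (hx : x ∈ (chartAt E p).source) (v : E) :
    ContMDiffAt 𝓘(ℝ, E) (𝓘(ℝ, E).prod 𝓘(ℝ, E)) ∞
      (fun z => Bundle.TotalSpace.mk' E (E := fun z : M => TangentSpace 𝓘(ℝ, E) z) z
        ((trivializationAt E (TangentSpace 𝓘(ℝ, E)) p).symmL ℝ z v)) x := by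
  set e := trivializationAt E (TangentSpace 𝓘(ℝ, E) : M → Type _) p
  have hx' : x ∈ e.baseSet := hx
  rw [e.contMDiffAt_section_iff hx']
  refine contMDiffAt_const (c := v) |>.congr_of_eventuallyEq ?_
  filter_upwards [e.open_baseSet.mem_nhds hx'] with z hz
  have := e.continuousLinearMapAt_symmL (R := ℝ) hz v
  rwa [Bundle.Trivialization.continuousLinearMapAt_apply, e.coe_linearMapAt_of_mem hz] at this

theorem symmL_eq_tangentFromChart {p : M} {y : E} (hy : y ∈ (extChartAt 𝓘(ℝ, E) p).target)
    (v : E) :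
    (trivializationAt E (TangentSpace 𝓘(ℝ, E)) p).symmL ℝ ((extChartAt 𝓘(ℝ, E) p).symm y) v =
      tangentFromChart p y v := by
  have := isManifold_one (E := E) (M := M)
  have hx : (extChartAt 𝓘(ℝ, E) p).symm y ∈ (chartAt E p).source := by
    rw [← extChartAt_source 𝓘(ℝ, E)]
    exact (extChartAt 𝓘(ℝ, E) p).map_target hy
  rw [TangentBundle.symmL_trivializationAt hx, (extChartAt 𝓘(ℝ, E) p).right_inv hy,
    modelWithCornersSelf_coe, Set.range_id, mfderivWithin_univ]
  rfl

theorem contDiffOn_comp_symm {F : Type*} [NormedAddCommGroup F] [NormedSpace ℝ F] {p : M}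
    {f : M → F} (hf : ∀ x ∈ (chartAt E p).source, ContMDiffAt 𝓘(ℝ, E) 𝓘(ℝ, F) ∞ f x) :
    ContDiffOn ℝ ∞ (f ∘ (extChartAt 𝓘(ℝ, E) p).symm) (extChartAt 𝓘(ℝ, E) p).target := by
  rw [← contMDiffOn_iff_contDiffOn]
  refine ContMDiffOn.comp (t := (chartAt E p).source) (fun x hx => (hf x hx).contMDiffWithinAt)
    (contMDiffOn_extChartAt_symm p) fun y hy => ?_
  rw [← extChartAt_source 𝓘(ℝ, E)]
  exact (extChartAt 𝓘(ℝ, E) p).map_target hy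

variable [FiniteDimensional ℝ E]

theorem contDiffOn_bilinInChart
    {B : ∀ x : M, TangentSpace 𝓘(ℝ, E) x →L[ℝ] TangentSpace 𝓘(ℝ, E) x →L[ℝ] ℝ}
    (hB : ContMDiff 𝓘(ℝ, E) (𝓘(ℝ, E).prod 𝓘(ℝ, E →L[ℝ] E →L[ℝ] ℝ)) ∞
      (fun x => Bundle.TotalSpace.mk' (E →L[ℝ] E →L[ℝ] ℝ)
        (E := fun x : M => TangentSpace 𝓘(ℝ, E) x →L[ℝ] TangentSpace 𝓘(ℝ, E) x →L[ℝ] ℝ) x (B x)))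
    (p : M) : ContDiffOn ℝ ∞ (bilinInChart B p) (extChartAt 𝓘(ℝ, E) p).target := by
  refine contDiffOn_clm_apply.2 fun v => contDiffOn_clm_apply.2 fun w => ?_
  set e := trivializationAt E (TangentSpace 𝓘(ℝ, E) : M → Type _) p
  have h : ∀ x ∈ (chartAt E p).source, ContMDiffAt 𝓘(ℝ, E) 𝓘(ℝ, ℝ) ∞
      (fun x => B x (e.symmL ℝ x v) (e.symmL ℝ x w)) x := by
    intro x hx
    have : ContMDiffAt 𝓘(ℝ, E) (𝓘(ℝ, E).prod 𝓘(ℝ)) ∞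
        (fun m ↦ Bundle.TotalSpace.mk' ℝ (E := Bundle.Trivial M ℝ) m
          (B m (e.symmL ℝ m v) (e.symmL ℝ m w))) x := by
      apply ContMDiffAt.clm_bundle_apply₂ (F₁ := E) (F₂ := E)
      · exact hB x
      · exact contMDiffAt_symmL hx v
      · exact contMDiffAt_symmL hx w
    rw [Bundle.contMDiffAt_totalSpace] at this
    exact this.2
  refine (contDiffOn_comp_symm h).congr fun y hy => ?_
  rw [bilinInChart_apply, ← symmL_eq_tangentFromChart hy, ← symmL_eq_tangentFromChart hy]
  rfl

theorem contDiffOn_endInChart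
    {J : ∀ x : M, TangentSpace 𝓘(ℝ, E) x →L[ℝ] TangentSpace 𝓘(ℝ, E) x}
    (hJ : ContMDiff 𝓘(ℝ, E) (𝓘(ℝ, E).prod 𝓘(ℝ, E →L[ℝ] E)) ∞
      (fun x => Bundle.TotalSpace.mk' (E →L[ℝ] E)
        (E := fun x : M => TangentSpace 𝓘(ℝ, E) x →L[ℝ] TangentSpace 𝓘(ℝ, E) x) x (J x)))
    (p : M) : ContDiffOn ℝ ∞ (endInChart J p) (extChartAt 𝓘(ℝ, E) p).target := by
  have := isManifold_one (E := E) (M := M)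
  refine contDiffOn_clm_apply.2 fun w => ?_
  set e := trivializationAt E (TangentSpace 𝓘(ℝ, E) : M → Type _) p
  have h : ∀ x ∈ (chartAt E p).source, ContMDiffAt 𝓘(ℝ, E) 𝓘(ℝ, E) ∞
      (fun x => (e ⟨x, J x (e.symmL ℝ x w)⟩).2) x := by
    intro x hx
    rw [← e.contMDiffAt_section_iff (show x ∈ e.baseSet from hx)]
    exact ContMDiffAt.clm_bundle_apply (F₁ := E) (F₂ := E) (hJ x) (contMDiffAt_symmL hx w)
  refine (contDiffOn_comp_symm h).congr fun y hy => ?_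
  have hx : (extChartAt 𝓘(ℝ, E) p).symm y ∈ (chartAt E p).source := by
    rw [← extChartAt_source 𝓘(ℝ, E)]
    exact (extChartAt 𝓘(ℝ, E) p).map_target hy
  rw [endInChart_apply, ← symmL_eq_tangentFromChart hy]
  have h2 := TangentBundle.continuousLinearMapAt_trivializationAt (𝕜 := ℝ) (I := 𝓘(ℝ, E)) hx
  refine (congrArg (fun L : E →L[ℝ] E => L (J _ (e.symmL ℝ _ w))) h2).symm.trans ?_
  change e.continuousLinearMapAt ℝ ((extChartAt 𝓘(ℝ, E) p).symm y) _ = _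
  rw [Bundle.Trivialization.continuousLinearMapAt_apply, e.coe_linearMapAt_of_mem hx]
  rfl

/-! ### The almost Kähler structure in the chart around a point -/

namespace AlmostKahlerStructure

variable (S : AlmostKahlerStructure E M)

omit [FiniteDimensional ℝ E] in
theorem metric_J_left (x : M) (v w : TangentSpace 𝓘(ℝ, E) x) :
    S.g.inner x (S.J x v) w = S.κ x v w := by
  rw [← S.metric_J, S.J_J, map_neg, _root_.neg_apply, S.calibrated, S.J_J, map_neg, neg_neg]

/-- An almost Kähler structure is one in the chart around each point, near the centre. -/
theorem isAlmostKahlerAt (p : M) :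
    IsAlmostKahlerAt (bilinInChart S.g.inner p) (endInChart S.J p)
      (extChartAt 𝓘(ℝ, E) p p) := by
  have ht : (extChartAt 𝓘(ℝ, E) p).target ∈ 𝓝 (extChartAt 𝓘(ℝ, E) p p) :=
    extChartAt_target_mem_nhds p
  have hgJ : ∀ᶠ z in 𝓝 (extChartAt 𝓘(ℝ, E) p p), ∀ a b,
      bilinInChart S.g.inner p z (endInChart S.J p z a) b = bilinInChart S.κ p z a b := by
    filter_upwards [ht] with z hz a b
    rw [bilinInChart_apply, endInChart_apply, tangentFromChart_tangentToChart hz]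
    exact S.metric_J_left _ _ _
  have hsymm : ∀ᶠ z in 𝓝 (extChartAt 𝓘(ℝ, E) p p), ∀ a b,
      bilinInChart S.g.inner p z a b = bilinInChart S.g.inner p z b a :=
    Eventually.of_forall fun z a b => S.g.symm _ _ _
  refine ⟨((contDiffOn_bilinInChart S.g.contMDiff p).contDiffAt ht).of_le
    (WithTop.coe_le_coe.2 (le_top : (2 : ℕ∞) ≤ ⊤)),
    ((contDiffOn_endInChart S.contMDiff_J p).contDiffAt ht).of_le
      (WithTop.coe_le_coe.2 (le_top : (2 : ℕ∞) ≤ ⊤)),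
    ?_, hsymm, ?_, ?_, fun u v w => ?_⟩
  · filter_upwards [ht] with z hz a ha
    rw [bilinInChart_apply]
    refine S.g.pos _ _ fun h0 => ha ?_
    rw [← tangentToChart_tangentFromChart hz a, h0, map_zero]
  · filter_upwards [ht] with z hz a
    rw [endInChart_apply, endInChart_apply, tangentFromChart_tangentToChart hz, S.J_J, map_neg,
      tangentToChart_tangentFromChart hz]
  · filter_upwards [hgJ, hsymm] with z h1 h2 a b
    rw [h1, h2, h1, bilinInChart_apply, bilinInChart_apply]
    exact S.κ_swap _ _ _
  · have e : (fun z => (bilinInChart S.g.inner p z).comp (endInChart S.J p z))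
        =ᶠ[𝓝 (extChartAt 𝓘(ℝ, E) p p)] bilinInChart S.κ p :=
      hgJ.mono fun z hz => by ext a b; exact hz a b
    rw [extDerivTwo, e.fderiv_eq]
    exact S.closed p u v w

omit [FiniteDimensional ℝ E] in
theorem span_mem_invariantPlanes {p : M} {v : TangentSpace 𝓘(ℝ, E) p} (hv : v ≠ 0) :
    Submodule.span ℝ {v, S.J p v} ∈ S.invariantPlanes p := by
  have hpos := S.g.pos p v hv
  refine ⟨?_, fun z hz => ?_⟩
  · have hli : LinearIndependent ℝ ![v, S.J p v] := by
      rw [LinearIndependent.pair_iff]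
      intro a b hab
      have h1 := congrArg (fun z => S.g.inner p v z) hab
      have h2 := congrArg (fun z => S.g.inner p (S.J p v) z) hab
      simp only [map_add, map_smul, map_zero, smul_eq_mul, S.metric_J_self] at h1
      simp only [map_add, map_smul, map_zero, smul_eq_mul, S.g.symm p (S.J p v) v,
        S.metric_J_self, S.metric_J] at h2
      constructor <;> nlinarith
    have h := finrank_span_eq_card hli
    have hr : Set.range ![v, S.J p v] = {v, S.J p v} := by
      simp [Matrix.range_cons, Set.pair_comm]
    rwa [hr] at h
  · obtain ⟨a, b, rfl⟩ := Submodule.mem_span_pair.1 hz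
    refine Submodule.mem_span_pair.2 ⟨-b, a, ?_⟩
    rw [map_add, map_smul, map_smul, S.J_J]
    module

/-- If the two bisectional curvatures agree, `∇J = 0`. The hypothesis gives `(∇_v J) w = 0` for the
chosen unit vectors of each pair of planes, hence for all vectors of these planes. -/
theorem covDerivEnd_eq_zero (hK : ∀ (p : M) (σ₁ σ₂ : S.invariantPlanes p),
      S.riemannianBisectional p σ₁ σ₂ = S.hermitianBisectional p σ₁ σ₂) (p : M) (v w : E) :
    covDerivEnd (christoffel (bilinInChart S.g.inner p)) (endInChart S.J p)
      (extChartAt 𝓘(ℝ, E) p p) v w = 0 := by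
  have h := S.isAlmostKahlerAt p
  by_cases hv : v = 0
  · simpa [hv] using covDerivEnd_lin_left (bilinInChart S.g.inner p) (endInChart S.J p)
      (extChartAt 𝓘(ℝ, E) p p) 0 0 0 0 w
  by_cases hw : w = 0
  · simpa [hw] using covDerivEnd_lin_right (bilinInChart S.g.inner p) (endInChart S.J p)
      (extChartAt 𝓘(ℝ, E) p p) 0 0 v 0 0
  let σ₁ : S.invariantPlanes p := ⟨_, S.span_mem_invariantPlanes (v := v) hv⟩
  let σ₂ : S.invariantPlanes p := ⟨_, S.span_mem_invariantPlanes (v := w) hw⟩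
  have h1 := (S.exists_unit σ₁.2).choose_spec.2
  have h2 := (S.exists_unit σ₂.2).choose_spec.2
  have hz : covDerivEnd (christoffel (bilinInChart S.g.inner p)) (endInChart S.J p)
      (extChartAt 𝓘(ℝ, E) p p) (S.unitVector σ₁) (S.unitVector σ₂) = 0 := by
    refine h.covDerivEnd_eq_zero ?_
    rw [bilinInChart_self, endInChart_self]
    exact hK p σ₁ σ₂
  refine h.covDerivEnd_eq_zero_of_mem_span hz ?_ ?_
  · rw [endInChart_self]
    exact h1.ge (Submodule.subset_span (Set.mem_insert _ _))
  · rw [endInChart_self]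
    exact h2.ge (Submodule.subset_span (Set.mem_insert _ _))

end AlmostKahlerStructure

/-! ### Vector fields and Lie brackets in the chart around a point -/

/-- The expression of a vector field in the chart around `p`. -/
def fieldInChart (X : ∀ x : M, TangentSpace 𝓘(ℝ, E) x) (p : M) (y : E) : E :=
  tangentToChart p y (X ((extChartAt 𝓘(ℝ, E) p).symm y))

omit [FiniteDimensional ℝ E] in
theorem mpullbackWithin_eventuallyEq (X : ∀ x : M, TangentSpace 𝓘(ℝ, E) x) (p : M) :
    VectorField.mpullbackWithin 𝓘(ℝ, E) 𝓘(ℝ, E) (extChartAt 𝓘(ℝ, E) p).symm X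
      (Set.range 𝓘(ℝ, E)) =ᶠ[𝓝 (extChartAt 𝓘(ℝ, E) p p)] fieldInChart X p := by
  filter_upwards [extChartAt_target_mem_nhds p] with y hy
  have h : (tangentFromChart p y).inverse = tangentToChart p y :=
    ContinuousLinearMap.inverse_eq
      (ContinuousLinearMap.ext (tangentFromChart_tangentToChart hy))
      (ContinuousLinearMap.ext (tangentToChart_tangentFromChart hy))
  rw [VectorField.mpullbackWithin_apply, modelWithCornersSelf_coe, Set.range_id,
    mfderivWithin_univ]
  exact congrArg (fun L => L (X ((extChartAt 𝓘(ℝ, E) p).symm y))) h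

theorem differentiableAt_fieldInChart {X : ∀ x : M, TangentSpace 𝓘(ℝ, E) x} {p : M}
    (hX : ContMDiffAt 𝓘(ℝ, E) (𝓘(ℝ, E).prod 𝓘(ℝ, E)) ∞
      (fun z => Bundle.TotalSpace.mk' E (E := fun z : M => TangentSpace 𝓘(ℝ, E) z) z (X z)) p) :
    DifferentiableAt ℝ (fieldInChart X p) (extChartAt 𝓘(ℝ, E) p p) := by
  have := isManifold_two (E := E) (M := M)
  have : CompleteSpace E := FiniteDimensional.complete ℝ E
  have h := ((hX.mdifferentiableAt (by simp)).mdifferentiableWithinAt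
    (s := Set.univ)).differentiableWithinAt_mpullbackWithin_vectorField
  rw [modelWithCornersSelf_coe, Set.range_id, Set.preimage_univ, Set.univ_inter] at h
  refine (DifferentiableWithinAt.differentiableAt (s := Set.univ) h
    Filter.univ_mem).congr_of_eventuallyEq (EventuallyEq.symm ?_)
  simpa using mpullbackWithin_eventuallyEq X p

omit [FiniteDimensional ℝ E] in
/-- The Lie bracket at `p` is that of the expressions in the chart around `p`, whose differential at
`p` is the canonical identification of `T_pM` with `E`. -/
theorem mlieBracket_eq (X Y : ∀ x : M, TangentSpace 𝓘(ℝ, E) x) (p : M) :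
    VectorField.mlieBracket 𝓘(ℝ, E) X Y p =
      VectorField.lieBracket ℝ (fieldInChart X p) (fieldInChart Y p)
        (extChartAt 𝓘(ℝ, E) p p) := by
  have := isManifold_one (E := E) (M := M)
  have h1 := Filter.EventuallyEq.lieBracket_vectorField_eq (𝕜 := ℝ) (V := fieldInChart X p)
    (W := fieldInChart Y p) (mpullbackWithin_eventuallyEq X p) (mpullbackWithin_eventuallyEq Y p)
  rw [← h1, VectorField.mlieBracket, VectorField.mlieBracketWithin_apply]
  have h2 := mfderiv_extChartAt_self (I := 𝓘(ℝ, E)) (x := p)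
  refine (congrArg (fun L : E →L[ℝ] E => L.inverse _) h2).trans ?_
  refine (congrArg (fun L : E →L[ℝ] E => L _)
    (ContinuousLinearMap.inverse_id (R := ℝ) (M := E))).trans ?_
  have h3 : ∀ V W : E → E, VectorField.lieBracketWithin ℝ V W
      ((extChartAt 𝓘(ℝ, E) p).symm ⁻¹' Set.univ ∩ Set.range 𝓘(ℝ, E))
      (extChartAt 𝓘(ℝ, E) p p) = VectorField.lieBracket ℝ V W (extChartAt 𝓘(ℝ, E) p p) := by
    intro V W
    simp
  exact h3 _ _

omit [FiniteDimensional ℝ E] in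
theorem fieldInChart_J (J : ∀ x : M, TangentSpace 𝓘(ℝ, E) x →L[ℝ] TangentSpace 𝓘(ℝ, E) x)
    (X : ∀ x : M, TangentSpace 𝓘(ℝ, E) x) (p : M) :
    fieldInChart (fun z => J z (X z)) p =ᶠ[𝓝 (extChartAt 𝓘(ℝ, E) p p)]
      fun y => endInChart J p y (fieldInChart X p y) := by
  filter_upwards [extChartAt_target_mem_nhds p] with y hy
  rw [endInChart_apply, fieldInChart, fieldInChart, tangentFromChart_tangentToChart hy]

end Charts

end AlmostKahler

end

/-- If on an almost Kähler manifold the Riemannian holomorphic bisectional curvature equals the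
Hermitian bisectional curvature, for all `J`-invariant planes at every point, then `J` is integrable
and the manifold is Kähler. -/
theorem theorem4p6 {E : Type*} [NormedAddCommGroup E] [NormedSpace ℝ E] [FiniteDimensional ℝ E]
    {M : Type*} [TopologicalSpace M] [ChartedSpace E M] [IsManifold 𝓘(ℝ, E) ∞ M]
    (S : AlmostKahler.AlmostKahlerStructure E M)
    (hK : ∀ (p : M) (σ₁ σ₂ : S.invariantPlanes p),
      S.riemannianBisectional p σ₁ σ₂ = S.hermitianBisectional p σ₁ σ₂) :
    AlmostKahler.IsIntegrable S.J ∧ S.IsKahler := by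
  suffices h : AlmostKahler.IsIntegrable S.J from ⟨h, h⟩
  intro p X Y hX hY
  have h := (S.isAlmostKahlerAt p).nijenhuis_eq_zero (S.covDerivEnd_eq_zero hK p)
    (AlmostKahler.differentiableAt_fieldInChart hX) (AlmostKahler.differentiableAt_fieldInChart hY)
  rw [AlmostKahler.endInChart_self] at h
  have hJX := AlmostKahler.fieldInChart_J S.J X p
  have hJY := AlmostKahler.fieldInChart_J S.J Y p
  simp only [AlmostKahler.nijenhuis, AlmostKahler.mlieBracket_eq]
  rw [hJX.lieBracket_vectorField_eq hJY, hJX.lieBracket_vectorField_eq Filter.EventuallyEq.rfl,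
    Filter.EventuallyEq.rfl.lieBracket_vectorField_eq hJY]
  exact h
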